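/- For a positive integer $d$, a nonnegative integer $n$ and reals $\varepsilon\in[0,1]$, $\alpha>0$, let $\mathcal D_0=\mathcal N(0,I)^{\otimes n}$ be the law of $n$ i.i.d. samples from the standard Gaussian on $\mathbb R^d$. Let $\mathcal D_1$ be the law of $(X_1,\dots,X_n)\in(\mathbb R^d)^n$ obtained by drawing $v\sim\mathcal N(0,\tfrac1d I)$ and then, conditionally on $v$, drawing $X_1,\dots,X_n$ i.i.d. from the mixture $$(1-\varepsilon)\,\mathcal N(\alpha v,I)+\varepsilon\,\mathcal N\!\left(-\tfrac{1-\varepsilon}{\varepsilon}\,\alpha v,\;I\right).$$ There is an absolute constant $c>0$ such that, whenever $$\varepsilon\le\alpha,\qquad n\le c\cdot\frac{d\varepsilon^3}{\alpha^4}\qquad\text{and}\qquad c\cdot\frac{d\varepsilon^3}{\alpha^4}\ge\frac{\sqrt d}{\alpha^2}$$ (in particular when $n=c\cdot d\varepsilon^3/\alpha^4$), the following two statements hold (when $\varepsilon=0$ the hypotheses cannot be satisfied). 1. $d_{\mathrm{TV}}(\mathcal D_0,\mathcal D_1)\le 0.1$, where $d_{\mathrm{TV}}(P,Q)=\sup_A|P(A)-Q(A)|$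 over measurable sets $A$. 2. No Gaussian mean tester using $n$ samples succeeds under Huber contamination: there is no measurable $\varphi:(\mathbb R^d)^n\to[0,1]$ ($\varphi(x)$ being the probability of rejecting on data $x$) such that $\mathbb E_{X\sim\mathcal N(0,I)^{\otimes n}}[\varphi(X)]\le\tfrac13$ and $\mathbb E_{X\sim((1-\varepsilon)\mathcal N(\mu,I)+\varepsilon Q)^{\otimes n}}[\varphi(X)]\ge\tfrac23$ for every $\mu\in\mathbb R^d$ with $\|\mu\|_2\ge\alpha$ and every probability distribution $Q$ on $\mathbb R^d$. -/

import Mathlib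

open MeasureTheory ProbabilityTheory
open scoped ENNReal

/-- Total variation distance `sup_A |μ(A) - ν(A)|`, the supremum over all measurable sets. -/
noncomputable def tvDist {Ω : Type*} [MeasurableSpace Ω] (μ ν : Measure Ω) : ℝ :=
  ⨆ A : {A : Set Ω // MeasurableSet A}, |μ.real A.1 - ν.real A.1|

/-- The normal distribution `N(m, I)` on `ℝ^d`. -/
noncomputable def gaussI {d : ℕ} (m : EuclideanSpace ℝ (Fin d)) :
    Measure (EuclideanSpace ℝ (Fin d)) :=
  multivariateGaussian m (1 : Matrix (Fin d) (Fin d) ℝ)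

/-- The mixture `(1 - ε) P + ε Q` (for `0 ≤ ε ≤ 1`): the distribution of one sample in the Huber
contamination model with inlier distribution `P` and corruption distribution `Q`. -/
noncomputable def huberMix {Ω : Type*} [MeasurableSpace Ω] (ε : ℝ) (P Q : Measure Ω) :
    Measure Ω :=
  ENNReal.ofReal (1 - ε) • P + ENNReal.ofReal ε • Q

/-- The law of `n` i.i.d. samples from `P`. -/
noncomputable def iidLaw {Ω : Type*} [MeasurableSpace Ω] (n : ℕ) (P : Measure Ω) :
    Measure (Fin n → Ω) :=
  Measure.pi fun _ => P

/-- The null distribution: `n` i.i.d. samples from `N(0, I)` on `ℝ^d`. -/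
noncomputable def nullLaw (d n : ℕ) : Measure (Fin n → EuclideanSpace ℝ (Fin d)) :=
  iidLaw n (gaussI 0)

/-- The mixture `(1 - ε) N(α v, I) + ε N(-((1 - ε) / ε) α v, I)`. -/
noncomputable def altSample {d : ℕ} (ε α : ℝ) (v : EuclideanSpace ℝ (Fin d)) :
    Measure (EuclideanSpace ℝ (Fin d)) :=
  huberMix ε (gaussI (α • v)) (gaussI ((-((1 - ε) / ε * α)) • v))

/-- The alternative distribution: first draw `v ∼ N(0, I / d)`; then, conditionally on `v`, draw
`n` i.i.d. samples from `(1 - ε) N(α v, I) + ε N(-((1 - ε) / ε) α v, I)`. -/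
noncomputable def altLaw (d n : ℕ) (ε α : ℝ) : Measure (Fin n → EuclideanSpace ℝ (Fin d)) :=
  (multivariateGaussian (0 : EuclideanSpace ℝ (Fin d))
    ((1 / (d : ℝ)) • (1 : Matrix (Fin d) (Fin d) ℝ))).bind fun v => iidLaw n (altSample ε α v)

/-- `φ` is a (possibly randomized) Gaussian mean tester on `n` samples which succeeds with
probability at least `2/3` under Huber contamination of the alternative: `φ x ∈ [0,1]` is the
probability of rejecting on data `x`; `φ` rejects with probability at most `1/3` on (uncorrupted)
samples from `N(0, I)`, and with probability at least `2/3` on samples from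
`(1 - ε) N(μ, I) + ε Q`, for every `μ` with `‖μ‖ ≥ α` and every corruption distribution `Q`. -/
structure IsHuberMeanTester (d n : ℕ) (ε α : ℝ)
    (φ : (Fin n → EuclideanSpace ℝ (Fin d)) → ℝ) : Prop where
  measurable : Measurable φ
  mem_Icc : ∀ x, φ x ∈ Set.Icc (0 : ℝ) 1
  null : ∫ x, φ x ∂(nullLaw d n) ≤ 1 / 3
  alt : ∀ (μ : EuclideanSpace ℝ (Fin d)) (Q : Measure (EuclideanSpace ℝ (Fin d)))
    [IsProbabilityMeasure Q], α ≤ ‖μ‖ →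
      2 / 3 ≤ ∫ x, φ x ∂(iidLaw n (huberMix ε (gaussI μ) Q))

instance gaussI_isProbabilityMeasure {d : ℕ} (m : EuclideanSpace ℝ (Fin d)) :
    IsProbabilityMeasure (gaussI m) := by
  unfold gaussI; infer_instance

theorem huberMix_isProbabilityMeasure {Ω : Type*} [MeasurableSpace Ω] {ε : ℝ} (h0 : 0 ≤ ε)
    (h1 : ε ≤ 1) (P Q : Measure Ω) [IsProbabilityMeasure P] [IsProbabilityMeasure Q] :
    IsProbabilityMeasure (huberMix ε P Q) := by
  constructor
  simp only [huberMix, Measure.add_apply, Measure.smul_apply, measure_univ, smul_eq_mul, mul_one]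
  rw [← ENNReal.ofReal_add (by linarith) h0]
  simp

section

open scoped MatrixOrder

theorem measurable_gaussI {d : ℕ} :
    Measurable (gaussI : EuclideanSpace ℝ (Fin d) → Measure (EuclideanSpace ℝ (Fin d))) := by
  refine Measure.measurable_of_measurable_coe _ fun s hs => ?_
  have h : ∀ m : EuclideanSpace ℝ (Fin d), gaussI m s =
      stdGaussian (EuclideanSpace ℝ (Fin d)) (Prod.mk m ⁻¹' {p | p.1 + p.2 ∈ s}) := by
    intro m
    rw [gaussI, multivariateGaussian, CFC.sqrt_one, map_one,
      Measure.map_apply (by fun_prop) hs]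
    rfl
  simp_rw [h]
  exact measurable_measure_prodMk_left (measurable_fst.add measurable_snd hs)

end

theorem measurable_altSample {d : ℕ} (ε α : ℝ) :
    Measurable (altSample ε α :
      EuclideanSpace ℝ (Fin d) → Measure (EuclideanSpace ℝ (Fin d))) := by
  refine Measure.measurable_of_measurable_coe _ fun s hs => ?_
  simp only [altSample, huberMix, Measure.add_apply, Measure.smul_apply, smul_eq_mul]
  have h (a : ℝ) : Measurable fun v : EuclideanSpace ℝ (Fin d) => gaussI (a • v) s :=
    (Measure.measurable_coe hs).comp (measurable_gaussI.comp (measurable_const_smul a))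
  exact ((h _).const_mul _).add ((h _).const_mul _)

/-- The sample law depends measurably on `v`, so `altLaw` is the intended mixture over `v`. -/
theorem measurable_iidLaw_altSample {d : ℕ} (n : ℕ) {ε : ℝ} (α : ℝ) (h0 : 0 ≤ ε) (h1 : ε ≤ 1) :
    Measurable fun v : EuclideanSpace ℝ (Fin d) => iidLaw n (altSample ε α v) := by
  have hp (v : EuclideanSpace ℝ (Fin d)) : IsProbabilityMeasure (altSample ε α v) :=
    huberMix_isProbabilityMeasure h0 h1 _ _
  have hq (v : EuclideanSpace ℝ (Fin d)) : IsProbabilityMeasure (iidLaw n (altSample ε α v)) := by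
    unfold iidLaw; infer_instance
  refine Measurable.measure_of_isPiSystem_of_isProbabilityMeasure generateFrom_pi.symm
    isPiSystem_pi ?_
  rintro _ ⟨t, ht, rfl⟩
  simp only [iidLaw, Measure.pi_pi]
  exact Finset.measurable_prod _ fun i _ =>
    (Measure.measurable_coe (show MeasurableSet (t i) from ht i (Set.mem_univ i))).comp (measurable_altSample ε α)

theorem altLaw_isProbabilityMeasure (d n : ℕ) {ε : ℝ} (α : ℝ) (h0 : 0 ≤ ε) (h1 : ε ≤ 1) :
    IsProbabilityMeasure (altLaw d n ε α) := by
  have hp (v : EuclideanSpace ℝ (Fin d)) : IsProbabilityMeasure (altSample ε α v) :=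
    huberMix_isProbabilityMeasure h0 h1 _ _
  refine isProbabilityMeasure_bind (measurable_iidLaw_altSample n α h0 h1).aemeasurable ?_
  exact Filter.Eventually.of_forall fun v => by unfold iidLaw; infer_instance

/-!
Conditionally on which samples are outliers, the alternative is a Gaussian rank-one spiked
covariance model. Give a sample the label `1` if it is an inlier and `-(1 - ε) / ε` if it is an
outlier, so that labels have mean zero and variance at most `1 / ε`, and let `z` be the vector of
the `n` labels. Given `z`, each of the `d` coordinates of the data is a vector in `ℝ^n` with law
`N(0, I + (α² / d) z zᵀ)`, independently over coordinates. Averaging over `v` first and treating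
`z` as the random spike leads to a second-moment computation: the likelihood ratios of `z` and
`z'` have inner product `(1 - (α² ⟪z, z'⟫ / d)²) ^ (-d / 2)`, which is at most
`exp (α⁴ ⟪z, z'⟫² / d)` when the spikes are small (`lintegral_mixLR_mul_le`).

The plain second moment is too large because of atypical labels, so it is truncated to
`‖z‖² ≤ 1000 N / ε` with `N = c₀ d ε³ / α⁴ ≥ n`. By Markov's inequality this discards mass at most
`1 / 1000`, and since `ε ≤ α` it keeps `α² ⟪z, z'⟫ / d` below a small constant. On the truncated
event, `⟪z, z'⟫`, a sum of `n` independent terms of variance at most `1 / ε²` bounded by `1 / ε²`,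
has a sub-Gaussian tail with rate of order `ε³ / N` (`sum_labelsProb_tail_le`), while
`α⁴ / d = c₀ ε³ / N`; for small `c₀` the truncated second moment is therefore close to `1`
(`sum_filter_exp_labelDot_sq_le`). Cauchy–Schwarz then bounds the advantage of every test
(`abs_integral_sub_integral_le`), and indicator functions give the total variation bound.

For testers, a Huber contamination with inlier mean `α v` is only covered by the guarantee when
`‖α v‖` reaches the separation, so the alternative is used with `2 α` in place of `α`: then
`‖v‖ ≥ 1 / 2` suffices, which holds with probability close to `1` because `d` is large
(`prior_norm_lt_le`).
-/

/-! ### Product measures and densities -/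

theorem lintegral_pi_prod {ι : Type*} [Fintype ι] {X : ι → Type*} [∀ i, MeasurableSpace (X i)]
    (μ : ∀ i, Measure (X i)) [∀ i, IsProbabilityMeasure (μ i)] {f : ∀ i, X i → ℝ≥0∞}
    (hf : ∀ i, Measurable (f i)) :
    ∫⁻ x, ∏ i, f i (x i) ∂(Measure.pi μ) = ∏ i, ∫⁻ x, f i x ∂(μ i) := by
  have h := lintegral_prod_eq_prod_lintegral_of_indepFun Finset.univ
    (fun i (x : ∀ i, X i) => f i (x i)) (iIndepFun_pi (μ := μ) fun i => (hf i).aemeasurable)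
    (fun i => (hf i).comp (measurable_pi_apply i))
  rw [h]
  refine Finset.prod_congr rfl fun i _ => ?_
  exact (measurePreserving_eval μ i).lintegral_comp (hf i)

theorem pi_withDensity {ι : Type*} [Fintype ι] {X : ι → Type*} [∀ i, MeasurableSpace (X i)]
    (μ : ∀ i, Measure (X i)) [∀ i, IsProbabilityMeasure (μ i)] {f : ∀ i, X i → ℝ≥0∞}
    (hf : ∀ i, Measurable (f i)) [∀ i, SigmaFinite ((μ i).withDensity (f i))] :
    Measure.pi (fun i => (μ i).withDensity (f i)) =
      (Measure.pi μ).withDensity fun x => ∏ i, f i (x i) := by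
  classical
  refine Measure.pi_eq fun s hs => ?_
  rw [withDensity_apply _ (MeasurableSet.univ_pi hs),
    ← lintegral_indicator (MeasurableSet.univ_pi hs)]
  have h : ∀ x : ∀ i, X i, (Set.univ.pi s).indicator (fun x => ∏ i, f i (x i)) x
      = ∏ i, (s i).indicator (f i) (x i) := by
    intro x
    by_cases hx : x ∈ Set.univ.pi s
    · rw [Set.indicator_of_mem hx]
      exact Finset.prod_congr rfl fun i _ => (Set.indicator_of_mem (hx i trivial) _).symm
    · rw [Set.indicator_of_notMem hx]
      simp only [Set.mem_pi, Set.mem_univ, true_imp_iff, not_forall] at hx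
      obtain ⟨i, hi⟩ := hx
      exact (Finset.prod_eq_zero (Finset.mem_univ i) (Set.indicator_of_notMem hi _)).symm
  simp_rw [h]
  rw [lintegral_pi_prod μ fun i => (hf i).indicator (hs i)]
  exact Finset.prod_congr rfl fun i _ => by
    rw [withDensity_apply _ (hs i), lintegral_indicator (hs i)]

/-! ### Gaussian measures -/

/-- The likelihood ratio `exp (⟪m, x⟫ - ‖m‖² / 2)` of `N(m, I)` with respect to `N(0, I)`. -/
noncomputable def gaussLR {d : ℕ} (m x : EuclideanSpace ℝ (Fin d)) : ℝ≥0∞ :=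
  ENNReal.ofReal (Real.exp (inner ℝ m x - ‖m‖ ^ 2 / 2))

@[fun_prop]
theorem Measurable.gaussLR {Ω : Type*} [MeasurableSpace Ω] {d : ℕ}
    {f g : Ω → EuclideanSpace ℝ (Fin d)} (hf : Measurable f) (hg : Measurable g) :
    Measurable fun ω => gaussLR (f ω) (g ω) := by
  unfold _root_.gaussLR
  exact ((((hf.inner hg).sub ((hf.norm.pow_const 2).div_const 2)).exp)).ennreal_ofReal

theorem gaussianReal_eq_withDensity (m : ℝ) :
    gaussianReal m 1 = (gaussianReal 0 1).withDensity
      fun x => ENNReal.ofReal (Real.exp (m * x - m ^ 2 / 2)) := by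
  rw [gaussianReal_of_var_ne_zero _ one_ne_zero, gaussianReal_of_var_ne_zero _ one_ne_zero,
    ← withDensity_mul _ (measurable_gaussianPDF _ _) (by fun_prop)]
  congr 1
  ext x
  rw [Pi.mul_apply, gaussianPDF_def, gaussianPDF_def,
    ← ENNReal.ofReal_mul (gaussianPDFReal_nonneg _ _ _)]
  simp only [gaussianPDFReal, NNReal.coe_one, mul_one]
  rw [mul_assoc, ← Real.exp_add]
  congr 3
  ring

theorem gaussI_eq_map_pi {d : ℕ} (m : EuclideanSpace ℝ (Fin d)) :
    gaussI m = (Measure.pi fun i => gaussianReal (m i) 1).map (WithLp.toLp 2) := by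
  apply Measure.ext_of_charFun (E := EuclideanSpace ℝ (Fin d))
  ext t
  rw [gaussI, charFun_multivariateGaussian Matrix.PosSemidef.one, charFun_pi]
  simp_rw [charFun_gaussianReal, ← Complex.exp_sum]
  congr 1
  simp only [Matrix.one_mulVec, PiLp.inner_apply, dotProduct, Finset.sum_sub_distrib,
    ← Finset.sum_mul, ← Finset.sum_div]
  push_cast
  simp [mul_comm, sq]

theorem gaussI_eq_withDensity {d : ℕ} (m : EuclideanSpace ℝ (Fin d)) :
    gaussI m = (gaussI 0).withDensity (gaussLR m) := by
  have hlr : Measurable (gaussLR m) := by fun_prop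
  have hme : Measurable (WithLp.toLp 2 : (Fin d → ℝ) → EuclideanSpace ℝ (Fin d)) := by fun_prop
  have hs (i : Fin d) : SigmaFinite ((gaussianReal 0 1).withDensity
      fun x => ENNReal.ofReal (Real.exp (m i * x - m i ^ 2 / 2))) := by
    rw [← gaussianReal_eq_withDensity]; infer_instance
  have hpi : Measure.pi (fun i => gaussianReal (m i) 1) =
      (Measure.pi fun _ : Fin d => gaussianReal 0 1).withDensity
        fun x => gaussLR m (WithLp.toLp 2 x) := by
    simp_rw [gaussianReal_eq_withDensity (m _)]
    rw [pi_withDensity _ fun i => by fun_prop]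
    congr 1
    ext x
    rw [← ENNReal.ofReal_prod_of_nonneg fun i _ => (Real.exp_pos _).le, ← Real.exp_sum, gaussLR,
      EuclideanSpace.real_norm_sq_eq, Finset.sum_sub_distrib, Finset.sum_div, PiLp.inner_apply]
    simp [mul_comm]
  ext s hs
  rw [gaussI_eq_map_pi m, hpi, Measure.map_apply hme hs, withDensity_apply _ (hme hs),
    withDensity_apply _ hs, gaussI_eq_map_pi 0, setLIntegral_map hs hlr hme]
  simp

theorem lintegral_gaussLR {d : ℕ} (m : EuclideanSpace ℝ (Fin d)) :
    ∫⁻ x, gaussLR m x ∂(gaussI 0) = 1 := by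
  have h := measure_univ (μ := gaussI m)
  rwa [gaussI_eq_withDensity, withDensity_apply _ MeasurableSet.univ, setLIntegral_univ] at h

theorem lintegral_exp_inner {d : ℕ} (m : EuclideanSpace ℝ (Fin d)) :
    ∫⁻ x, ENNReal.ofReal (Real.exp (inner ℝ m x)) ∂(gaussI 0) =
      ENNReal.ofReal (Real.exp (‖m‖ ^ 2 / 2)) := by
  have h (x : EuclideanSpace ℝ (Fin d)) : ENNReal.ofReal (Real.exp (inner ℝ m x)) =
      ENNReal.ofReal (Real.exp (‖m‖ ^ 2 / 2)) * gaussLR m x := by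
    rw [gaussLR, ← ENNReal.ofReal_mul (Real.exp_pos _).le, ← Real.exp_add]
    congr 2; ring
  simp_rw [h]
  rw [lintegral_const_mul _ (by fun_prop), lintegral_gaussLR, mul_one]

/-- The chi-square inner product of two unit-covariance Gaussians is the exponential of the inner
product of their means. -/
theorem lintegral_gaussLR_mul {d : ℕ} (u w : EuclideanSpace ℝ (Fin d)) :
    ∫⁻ x, gaussLR u x * gaussLR w x ∂(gaussI 0) = ENNReal.ofReal (Real.exp (inner ℝ u w)) := by
  have h (x : EuclideanSpace ℝ (Fin d)) : gaussLR u x * gaussLR w x =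
      ENNReal.ofReal (Real.exp (inner ℝ u w)) * gaussLR (u + w) x := by
    rw [gaussLR, gaussLR, gaussLR, ← ENNReal.ofReal_mul (Real.exp_pos _).le, ← Real.exp_add,
      ← ENNReal.ofReal_mul (Real.exp_pos _).le, ← Real.exp_add, norm_add_sq_real, inner_add_left]
    congr 2; ring
  simp_rw [h]
  rw [lintegral_const_mul _ (by fun_prop), lintegral_gaussLR, mul_one]

theorem lintegral_exp_mul_sq_gaussianReal {a : ℝ} (ha : a < 1 / 2) :
    ∫⁻ x, ENNReal.ofReal (Real.exp (a * x ^ 2)) ∂(gaussianReal 0 1) =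
      ENNReal.ofReal (√(1 - 2 * a))⁻¹ := by
  have hb : 0 < 1 / 2 - a := by linarith
  rw [gaussianReal_of_var_ne_zero _ one_ne_zero,
    lintegral_withDensity_eq_lintegral_mul _ (measurable_gaussianPDF _ _) (by fun_prop)]
  have h (x : ℝ) : (gaussianPDF 0 1 * fun x => ENNReal.ofReal (Real.exp (a * x ^ 2))) x =
      ENNReal.ofReal ((√(2 * Real.pi))⁻¹ * Real.exp (-(1 / 2 - a) * x ^ 2)) := by
    rw [Pi.mul_apply, gaussianPDF_def, ← ENNReal.ofReal_mul (gaussianPDFReal_nonneg _ _ _)]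
    simp only [gaussianPDFReal, NNReal.coe_one, mul_one]
    rw [mul_assoc, ← Real.exp_add]
    congr 3
    ring
  simp_rw [h]
  rw [← ofReal_integral_eq_lintegral_ofReal ((integrable_exp_neg_mul_sq hb).const_mul _)
    (Filter.Eventually.of_forall fun x => by positivity), integral_const_mul, integral_gaussian,
    ← Real.sqrt_inv, ← Real.sqrt_inv, ← Real.sqrt_mul (by positivity)]
  congr 2
  have := Real.pi_ne_zero
  have h2 : 1 - 2 * a ≠ 0 := by linarith
  field_simp

theorem lintegral_exp_mul_norm_sq {d : ℕ} {a : ℝ} (ha : a < 1 / 2) :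
    ∫⁻ x, ENNReal.ofReal (Real.exp (a * ‖x‖ ^ 2)) ∂(gaussI (0 : EuclideanSpace ℝ (Fin d))) =
      ENNReal.ofReal ((√(1 - 2 * a))⁻¹ ^ d) := by
  rw [gaussI_eq_map_pi 0, lintegral_map (by fun_prop) (by fun_prop)]
  have h (x : Fin d → ℝ) : ENNReal.ofReal (Real.exp (a * ‖WithLp.toLp 2 x‖ ^ 2)) =
      ∏ i, ENNReal.ofReal (Real.exp (a * x i ^ 2)) := by
    rw [← ENNReal.ofReal_prod_of_nonneg fun i _ => (Real.exp_pos _).le, ← Real.exp_sum,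
      EuclideanSpace.real_norm_sq_eq, Finset.mul_sum]
  simp_rw [h, PiLp.zero_apply]
  rw [lintegral_pi_prod (fun _ : Fin d => gaussianReal 0 1)
    (f := fun _ x => ENNReal.ofReal (Real.exp (a * x ^ 2))) fun i => by fun_prop]
  simp_rw [lintegral_exp_mul_sq_gaussianReal ha]
  rw [Finset.prod_const, Finset.card_univ, Fintype.card_fin, ENNReal.ofReal_pow (by positivity)]

/-- The prior `N(0, I / d)` is the law of a rescaled standard Gaussian vector. -/
theorem multivariateGaussian_prior_eq_map {d : ℕ} :
    multivariateGaussian (0 : EuclideanSpace ℝ (Fin d))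
      ((1 / (d : ℝ)) • (1 : Matrix (Fin d) (Fin d) ℝ)) =
      (gaussI 0).map fun x => (√(d : ℝ))⁻¹ • x := by
  apply Measure.ext_of_charFun (E := EuclideanSpace ℝ (Fin d))
  ext t
  rw [charFun_map_smul, gaussI, charFun_multivariateGaussian Matrix.PosSemidef.one,
    charFun_multivariateGaussian (Matrix.PosSemidef.one.smul (by positivity))]
  congr 1
  have h : (√(d : ℝ))⁻¹ * (√(d : ℝ))⁻¹ = (d : ℝ)⁻¹ := by
    rw [← mul_inv]; rw [Real.mul_self_sqrt (by positivity)]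
  simp [Matrix.smul_mulVec, h, ← mul_assoc]

/-! ### The random labels -/

/-- The coefficient of `α v` in the mean of a sample: `1` for an inlier (`false`) and
`-(1 - ε) / ε` for an outlier (`true`). -/
noncomputable def label (ε : ℝ) (b : Bool) : ℝ := if b then -((1 - ε) / ε) else 1

/-- The probability of being an inlier (`false`) or an outlier (`true`). -/
noncomputable def labelProb (ε : ℝ) (b : Bool) : ℝ := if b then ε else 1 - ε

/-- The probability that `n` independent samples carry the labels `z`. -/
noncomputable def labelsProb {n : ℕ} (ε : ℝ) (z : Fin n → Bool) : ℝ := ∏ i, labelProb ε (z i)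

/-- The inner product of two label vectors. -/
noncomputable def labelDot {n : ℕ} (ε : ℝ) (z z' : Fin n → Bool) : ℝ :=
  ∑ i, label ε (z i) * label ε (z' i)

section

variable {n : ℕ} {ε : ℝ}

theorem labelProb_nonneg (h0 : 0 ≤ ε) (h1 : ε ≤ 1) (b : Bool) : 0 ≤ labelProb ε b := by
  cases b <;> simp [labelProb] <;> linarith

theorem labelsProb_nonneg (h0 : 0 ≤ ε) (h1 : ε ≤ 1) (z : Fin n → Bool) : 0 ≤ labelsProb ε z :=
  Finset.prod_nonneg fun i _ => labelProb_nonneg h0 h1 (z i)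

theorem sum_labelProb : ∑ b, labelProb ε b = 1 := by simp [labelProb]

theorem sum_labelProb_mul_label (h0 : 0 < ε) : ∑ b, labelProb ε b * label ε b = 0 := by
  simp [labelProb, label]; field_simp; ring

theorem sum_labelProb_mul_label_sq (h0 : 0 < ε) :
    ∑ b, labelProb ε b * label ε b ^ 2 = (1 - ε) / ε := by
  simp [labelProb, label]; field_simp; ring

theorem abs_label_le (h0 : 0 < ε) (h1 : ε ≤ 1) (b : Bool) : |label ε b| ≤ 1 / ε := by
  cases b
  · simp only [label, Bool.false_eq_true, if_false, abs_one]
    rwa [le_div_iff₀ h0, one_mul]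
  · simp only [label, if_true, abs_neg]
    rw [abs_of_nonneg (div_nonneg (by linarith) h0.le)]
    gcongr; linarith

theorem sum_prod_apply {R : Type*} [CommSemiring R] (f : Fin n → Bool → R) :
    ∑ z : Fin n → Bool, ∏ i, f i (z i) = ∏ i, ∑ b, f i b := by
  rw [Finset.prod_univ_sum, Fintype.piFinset_univ]

theorem sum_labelsProb : ∑ z : Fin n → Bool, labelsProb ε z = 1 := by
  simp_rw [labelsProb, sum_prod_apply fun _ => labelProb ε, sum_labelProb, Finset.prod_const_one]

theorem sum_labelsProb_mul_labelDot_self (h0 : 0 < ε) :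
    ∑ z : Fin n → Bool, labelsProb ε z * labelDot ε z z = n * ((1 - ε) / ε) := by
  simp_rw [labelDot, Finset.mul_sum]
  rw [Finset.sum_comm]
  have h (i : Fin n) : ∑ z : Fin n → Bool, labelsProb ε z * (label ε (z i) * label ε (z i)) =
      (1 - ε) / ε := by
    have hz (z : Fin n → Bool) : labelsProb ε z * (label ε (z i) * label ε (z i)) =
        ∏ j, labelProb ε (z j) * (if j = i then label ε (z j) ^ 2 else 1) := by
      rw [Finset.prod_mul_distrib, Finset.prod_ite_eq' Finset.univ i]
      simp [labelsProb, sq]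
    simp_rw [hz]
    rw [sum_prod_apply fun j b => labelProb ε b * (if j = i then label ε b ^ 2 else 1),
      Finset.prod_eq_single i]
    · simpa using sum_labelProb_mul_label_sq h0
    · intro j _ hj
      simpa [hj] using sum_labelProb (ε := ε)
    · simp
  simp [h]

/-- Markov's inequality for the squared norm of the label vector. -/
theorem sum_labelsProb_filter_le (h0 : 0 < ε) (h1 : ε ≤ 1) {R : ℝ} (hR : 0 < R) :
    ∑ z : Fin n → Bool with ¬ labelDot ε z z ≤ R, labelsProb ε z ≤ n / ε / R := by
  rw [le_div_iff₀ hR, Finset.sum_mul]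
  calc ∑ z : Fin n → Bool with ¬ labelDot ε z z ≤ R, labelsProb ε z * R
      ≤ ∑ z : Fin n → Bool with ¬ labelDot ε z z ≤ R, labelsProb ε z * labelDot ε z z := by
        refine Finset.sum_le_sum fun z hz => ?_
        rw [Finset.mem_filter, not_le] at hz
        exact mul_le_mul_of_nonneg_left hz.2.le (labelsProb_nonneg h0.le h1 z)
    _ ≤ ∑ z : Fin n → Bool, labelsProb ε z * labelDot ε z z :=
        Finset.sum_le_sum_of_subset_of_nonneg (Finset.filter_subset _ _) fun z _ _ =>
          mul_nonneg (labelsProb_nonneg h0.le h1 z)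
            (Finset.sum_nonneg fun i _ => mul_self_nonneg _)
    _ = n * ((1 - ε) / ε) := sum_labelsProb_mul_labelDot_self h0
    _ ≤ n / ε := by
        rw [mul_div_assoc', div_le_div_iff_of_pos_right h0]
        nlinarith [(Nat.cast_nonneg n : (0 : ℝ) ≤ n)]

theorem abs_labelDot_le (z z' : Fin n → Bool) {R : ℝ} (hz : labelDot ε z z ≤ R)
    (hz' : labelDot ε z' z' ≤ R) : |labelDot ε z z'| ≤ R := by
  have h : |labelDot ε z z'| ≤ (labelDot ε z z + labelDot ε z' z') / 2 := by
    simp only [labelDot, ← Finset.sum_add_distrib, Finset.sum_div]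
    refine (Finset.abs_sum_le_sum_abs _ _).trans (Finset.sum_le_sum fun i _ => ?_)
    rw [abs_le]
    constructor <;> nlinarith [sq_nonneg (label ε (z i) + label ε (z' i)),
      sq_nonneg (label ε (z i) - label ε (z' i))]
  linarith

theorem sum_sum_labelProb_mul_exp_le (h0 : 0 < ε) (h1 : ε ≤ 1) {θ : ℝ} (hθ : |θ| ≤ ε ^ 2) :
    ∑ b, labelProb ε b * ∑ b', labelProb ε b' * Real.exp (θ * (label ε b * label ε b')) ≤
      Real.exp (θ ^ 2 / ε ^ 2) := by
  have hpt (b b' : Bool) : Real.exp (θ * (label ε b * label ε b')) ≤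
      1 + θ * (label ε b * label ε b') + θ ^ 2 * (label ε b ^ 2 * label ε b' ^ 2) := by
    have hx : |θ * (label ε b * label ε b')| ≤ 1 := by
      rw [abs_mul, abs_mul]
      calc |θ| * (|label ε b| * |label ε b'|) ≤ ε ^ 2 * (1 / ε * (1 / ε)) := by
            gcongr <;> exact abs_label_le h0 h1 _
        _ = 1 := by field_simp
    have := (abs_le.1 (Real.abs_exp_sub_one_sub_id_le hx)).2
    nlinarith
  have hA := sum_labelProb (ε := ε)
  have hB := sum_labelProb_mul_label h0
  have hC := sum_labelProb_mul_label_sq h0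
  calc ∑ b, labelProb ε b * ∑ b', labelProb ε b' * Real.exp (θ * (label ε b * label ε b'))
      ≤ ∑ b, labelProb ε b * ∑ b', labelProb ε b' *
          (1 + θ * (label ε b * label ε b') + θ ^ 2 * (label ε b ^ 2 * label ε b' ^ 2)) := by
        refine Finset.sum_le_sum fun b _ => mul_le_mul_of_nonneg_left ?_
          (labelProb_nonneg h0.le h1 b)
        exact Finset.sum_le_sum fun b' _ => mul_le_mul_of_nonneg_left (hpt b b')
          (labelProb_nonneg h0.le h1 b')
    _ = (∑ b, labelProb ε b) ^ 2 + θ * (∑ b, labelProb ε b * label ε b) ^ 2 +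
          θ ^ 2 * (∑ b, labelProb ε b * label ε b ^ 2) ^ 2 := by
        simp only [Fintype.sum_bool]; ring
    _ = 1 + θ ^ 2 * ((1 - ε) / ε) ^ 2 := by rw [hA, hB, hC]; ring
    _ ≤ 1 + θ ^ 2 / ε ^ 2 := by
        rw [div_pow, mul_div_assoc', add_le_add_iff_left]
        gcongr
        have : (1 - ε) ^ 2 ≤ 1 := by nlinarith
        nlinarith [sq_nonneg θ]
    _ ≤ Real.exp (θ ^ 2 / ε ^ 2) := by linarith [Real.add_one_le_exp (θ ^ 2 / ε ^ 2)]

/-- The inner product of two independent label vectors has a sub-Gaussian moment generating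
function with variance proxy of order `n / ε ^ 2`, in the range `|θ| ≤ ε ^ 2`. -/
theorem sum_labelsProb_mul_exp_labelDot_le (h0 : 0 < ε) (h1 : ε ≤ 1) {θ : ℝ}
    (hθ : |θ| ≤ ε ^ 2) :
    ∑ p : (Fin n → Bool) × (Fin n → Bool),
      labelsProb ε p.1 * labelsProb ε p.2 * Real.exp (θ * labelDot ε p.1 p.2) ≤
      Real.exp (n * (θ ^ 2 / ε ^ 2)) := by
  have h (z z' : Fin n → Bool) :
      labelsProb ε z * labelsProb ε z' * Real.exp (θ * labelDot ε z z') =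
        labelsProb ε z *
          ∏ i, labelProb ε (z' i) * Real.exp (θ * (label ε (z i) * label ε (z' i))) := by
    rw [labelDot, Finset.mul_sum, Real.exp_sum, Finset.prod_mul_distrib, mul_assoc]
    rfl
  rw [Fintype.sum_prod_type]
  simp_rw [h, ← Finset.mul_sum]
  have h2 (z : Fin n → Bool) : labelsProb ε z * ∑ z' : Fin n → Bool,
        ∏ i, labelProb ε (z' i) * Real.exp (θ * (label ε (z i) * label ε (z' i))) =
      ∏ i, labelProb ε (z i) *
        ∑ b', labelProb ε b' * Real.exp (θ * (label ε (z i) * label ε b')) := by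
    rw [sum_prod_apply fun i b' =>
      labelProb ε b' * Real.exp (θ * (label ε (z i) * label ε b')), Finset.prod_mul_distrib]
    rfl
  simp_rw [h2]
  rw [sum_prod_apply fun _ b => labelProb ε b *
        ∑ b', labelProb ε b' * Real.exp (θ * (label ε b * label ε b')), Real.exp_nat_mul,
    Finset.prod_const, Finset.card_univ, Fintype.card_fin]
  refine pow_le_pow_left₀ (Finset.sum_nonneg fun b _ => mul_nonneg (labelProb_nonneg h0.le h1 b)
    (Finset.sum_nonneg fun b' _ => mul_nonneg (labelProb_nonneg h0.le h1 b') (Real.exp_pos _).le))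
    (sum_sum_labelProb_mul_exp_le h0 h1 hθ) n

/-- Chernoff tail bound for the inner product of two independent label vectors, with exponent
`θ = μ * s` proportional to the level `s`. -/
theorem sum_labelsProb_tail_le (h0 : 0 < ε) (h1 : ε ≤ 1) {μ s : ℝ} (hμ : 0 ≤ μ) (hs : 0 ≤ s)
    (hμs : μ * s ≤ ε ^ 2) (hμn : n * μ ≤ ε ^ 2 / 2) :
    ∑ p : (Fin n → Bool) × (Fin n → Bool),
      labelsProb ε p.1 * labelsProb ε p.2 * (if s ≤ |labelDot ε p.1 p.2| then 1 else 0) ≤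
      2 * Real.exp (-(μ / 2) * s ^ 2) := by
  have hθ : |μ * s| ≤ ε ^ 2 := by rwa [abs_of_nonneg (mul_nonneg hμ hs)]
  have hpt (S : ℝ) : (if s ≤ |S| then (1 : ℝ) else 0) ≤
      Real.exp (-(μ * s) * s) * (Real.exp (μ * s * S) + Real.exp (-(μ * s) * S)) := by
    split_ifs with h
    · rw [mul_add, ← Real.exp_add, ← Real.exp_add]
      rcases le_abs.1 h with h | h
      · have : 1 ≤ Real.exp (-(μ * s) * s + μ * s * S) :=
          Real.one_le_exp (by nlinarith [mul_nonneg hμ hs])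
        linarith [Real.exp_pos (-(μ * s) * s + -(μ * s) * S)]
      · have : 1 ≤ Real.exp (-(μ * s) * s + -(μ * s) * S) :=
          Real.one_le_exp (by nlinarith [mul_nonneg hμ hs])
        linarith [Real.exp_pos (-(μ * s) * s + μ * s * S)]
    · positivity
  have hm1 := sum_labelsProb_mul_exp_labelDot_le (n := n) h0 h1 hθ
  have hm2 := sum_labelsProb_mul_exp_labelDot_le (n := n) h0 h1 (θ := -(μ * s)) (by rwa [abs_neg])
  rw [neg_sq] at hm2
  calc _ ≤ ∑ p : (Fin n → Bool) × (Fin n → Bool), labelsProb ε p.1 * labelsProb ε p.2 *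
          (Real.exp (-(μ * s) * s) * (Real.exp (μ * s * labelDot ε p.1 p.2) +
            Real.exp (-(μ * s) * labelDot ε p.1 p.2))) :=
        Finset.sum_le_sum fun p _ => mul_le_mul_of_nonneg_left (hpt _)
          (mul_nonneg (labelsProb_nonneg h0.le h1 _) (labelsProb_nonneg h0.le h1 _))
    _ = Real.exp (-(μ * s) * s) * (∑ p : (Fin n → Bool) × (Fin n → Bool),
          labelsProb ε p.1 * labelsProb ε p.2 * Real.exp (μ * s * labelDot ε p.1 p.2) +
          ∑ p : (Fin n → Bool) × (Fin n → Bool),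
          labelsProb ε p.1 * labelsProb ε p.2 * Real.exp (-(μ * s) * labelDot ε p.1 p.2)) := by
        rw [← Finset.sum_add_distrib, Finset.mul_sum]
        exact Finset.sum_congr rfl fun p _ => by ring
    _ ≤ Real.exp (-(μ * s) * s) * (2 * Real.exp (n * ((μ * s) ^ 2 / ε ^ 2))) := by
        gcongr; linarith
    _ = 2 * Real.exp (-(μ * s) * s + n * ((μ * s) ^ 2 / ε ^ 2)) := by rw [Real.exp_add]; ring
    _ ≤ 2 * Real.exp (-(μ / 2) * s ^ 2) := by
        gcongr
        have : n * ((μ * s) ^ 2 / ε ^ 2) = (n * μ) / ε ^ 2 * (μ * s ^ 2) := by ring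
        have h2 : (n * μ) / ε ^ 2 ≤ 1 / 2 := by
          rw [div_le_iff₀ (by positivity)]; linarith
        rw [this]
        nlinarith [mul_nonneg hμ (sq_nonneg s)]

/-- Layer-cake bound: a sub-Gaussian tail with rate `β` makes the exponential moment of `lam * Y²`
close to `1` when `lam` is small compared with `β`. -/
theorem sum_mul_exp_sq_le {ι : Type*} [Fintype ι] {w Y : ι → ℝ} {R lam β : ℝ}
    (hw1 : ∑ i, w i ≤ 1) (hR : 0 ≤ R) (hY : ∀ i, Y i ∈ Set.Icc 0 R)
    (hl : 0 ≤ lam) (hlβ : lam < β)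
    (htail : ∀ s ∈ Set.Icc 0 R, ∑ i, w i * (if s ≤ Y i then 1 else 0) ≤
      2 * Real.exp (-β * s ^ 2)) :
    ∑ i, w i * Real.exp (lam * Y i ^ 2) ≤ 1 + 2 * lam / (β - lam) := by
  have hderiv (a x : ℝ) : HasDerivAt (fun s => Real.exp (a * s ^ 2))
      (2 * a * x * Real.exp (a * x ^ 2)) x := by
    have := ((hasDerivAt_pow 2 x).const_mul a).exp
    refine this.congr_deriv ?_
    simp; ring
  have hint (a y : ℝ) : ∫ s in (0 : ℝ)..y, 2 * a * s * Real.exp (a * s ^ 2) =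
      Real.exp (a * y ^ 2) - 1 := by
    rw [intervalIntegral.integral_eq_sub_of_hasDerivAt (fun x _ => hderiv a x)
      (Continuous.intervalIntegrable (by fun_prop) _ _)]
    simp
  have hrep (i : ι) : Real.exp (lam * Y i ^ 2) = 1 + ∫ s in (0 : ℝ)..R,
      {s | s ≤ Y i}.indicator (fun s => 2 * lam * s * Real.exp (lam * s ^ 2)) s := by
    rw [intervalIntegral.integral_indicator (hY i), hint]; ring
  have hii (i : ι) : IntervalIntegrable ({s | s ≤ Y i}.indicator
      (fun s => 2 * lam * s * Real.exp (lam * s ^ 2))) volume 0 R := by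
    have : IntervalIntegrable (fun s => 2 * lam * s * Real.exp (lam * s ^ 2)) volume 0 R :=
      Continuous.intervalIntegrable (by fun_prop) _ _
    rw [intervalIntegrable_iff] at this ⊢
    exact this.indicator measurableSet_Iic
  have hsum : ∑ i, w i * Real.exp (lam * Y i ^ 2) = ∑ i, w i + ∫ s in (0 : ℝ)..R,
      ∑ i, w i * {s | s ≤ Y i}.indicator (fun s => 2 * lam * s * Real.exp (lam * s ^ 2)) s := by
    rw [intervalIntegral.integral_finsetSum fun i _ => (hii i).const_mul _,
      ← Finset.sum_add_distrib]
    refine Finset.sum_congr rfl fun i _ => ?_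
    rw [intervalIntegral.integral_const_mul, hrep i]; ring
  have hγ : 0 < β - lam := by linarith
  have hle : ∫ s in (0 : ℝ)..R,
      ∑ i, w i * {s | s ≤ Y i}.indicator (fun s => 2 * lam * s * Real.exp (lam * s ^ 2)) s ≤
      ∫ s in (0 : ℝ)..R, (-(2 * lam / (β - lam))) *
        (2 * -(β - lam) * s * Real.exp (-(β - lam) * s ^ 2)) := by
    refine intervalIntegral.integral_mono_on hR ?_
      (Continuous.intervalIntegrable (by fun_prop) _ _) fun s hs => ?_
    · have := IntervalIntegrable.sum (μ := volume) Finset.univ fun i (_ : i ∈ Finset.univ) =>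
        (hii i).const_mul (w i)
      simpa only [Finset.sum_fn] using this
    · have h1 : ∑ i, w i * {s | s ≤ Y i}.indicator
          (fun s => 2 * lam * s * Real.exp (lam * s ^ 2)) s =
          (∑ i, w i * (if s ≤ Y i then 1 else 0)) * (2 * lam * s * Real.exp (lam * s ^ 2)) := by
        rw [Finset.sum_mul]
        refine Finset.sum_congr rfl fun i _ => ?_
        by_cases h : s ≤ Y i <;> simp [Set.indicator, h]
      rw [h1]
      have h2 : 0 ≤ 2 * lam * s * Real.exp (lam * s ^ 2) := by
        have := hs.1
        positivity
      refine (mul_le_mul_of_nonneg_right (htail s hs) h2).trans (le_of_eq ?_)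
      have h3 : Real.exp (-(β - lam) * s ^ 2) =
          Real.exp (-β * s ^ 2) * Real.exp (lam * s ^ 2) := by
        rw [← Real.exp_add]; ring_nf
      rw [h3]
      field_simp
  rw [intervalIntegral.integral_const_mul, hint] at hle
  have h4 : 0 ≤ 2 * lam / (β - lam) * Real.exp (-(β - lam) * R ^ 2) := by positivity
  rw [hsum]
  nlinarith

/-- The truncated second moment: on the event that both label vectors have squared norm at most
`1000 * N / ε`, the exponential moment of the squared inner product is close to `1`. -/
theorem sum_filter_exp_labelDot_sq_le (h0 : 0 < ε) (h1 : ε ≤ 1) {N : ℝ} (hN : 0 < N)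
    (hn : (n : ℝ) ≤ N) :
    ∑ z : Fin n → Bool with labelDot ε z z ≤ 1000 * N / ε,
      ∑ z' : Fin n → Bool with labelDot ε z' z' ≤ 1000 * N / ε,
        labelsProb ε z * labelsProb ε z' *
          Real.exp (1e-7 * ε ^ 3 / N * labelDot ε z z' ^ 2) ≤ 1.001 := by
  classical
  set R := 1000 * N / ε with hRdef
  have hR : 0 < R := by positivity
  set G : Finset (Fin n → Bool) := Finset.univ.filter fun z => labelDot ε z z ≤ R with hG
  set w : (Fin n → Bool) × (Fin n → Bool) → ℝ := fun p =>
    if p ∈ G ×ˢ G then labelsProb ε p.1 * labelsProb ε p.2 else 0 with hw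
  set Y : (Fin n → Bool) × (Fin n → Bool) → ℝ := fun p => min |labelDot ε p.1 p.2| R with hY
  have hpp (p : (Fin n → Bool) × (Fin n → Bool)) : 0 ≤ labelsProb ε p.1 * labelsProb ε p.2 :=
    mul_nonneg (labelsProb_nonneg h0.le h1 _) (labelsProb_nonneg h0.le h1 _)
  have hwle (p) : w p ≤ labelsProb ε p.1 * labelsProb ε p.2 := by
    simp only [hw]; split_ifs
    · exact le_rfl
    · exact hpp p
  have hYeq (p) (hp : p ∈ G ×ˢ G) : Y p ^ 2 = labelDot ε p.1 p.2 ^ 2 := by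
    rw [Finset.mem_product, hG, Finset.mem_filter, Finset.mem_filter] at hp
    rw [hY]
    simp only [min_eq_left (abs_labelDot_le p.1 p.2 hp.1.2 hp.2.2), sq_abs]
  have hlhs : ∑ z ∈ G, ∑ z' ∈ G, labelsProb ε z * labelsProb ε z' *
      Real.exp (1e-7 * ε ^ 3 / N * labelDot ε z z' ^ 2) =
      ∑ p, w p * Real.exp (1e-7 * ε ^ 3 / N * Y p ^ 2) := by
    rw [← Finset.sum_product' G G fun z z' => labelsProb ε z * labelsProb ε z' *
      Real.exp (1e-7 * ε ^ 3 / N * labelDot ε z z' ^ 2)]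
    rw [← Finset.sum_subset (Finset.subset_univ (G ×ˢ G)) fun p _ hp => by
      simp only [hw, if_neg hp, zero_mul]]
    refine Finset.sum_congr rfl fun p hp => ?_
    rw [hYeq p hp]
    simp only [hw, if_pos hp]
  rw [hlhs]
  have hsum1 : ∑ p, w p ≤ 1 := by
    refine (Finset.sum_le_sum fun p _ => hwle p).trans (le_of_eq ?_)
    rw [Fintype.sum_prod_type]
    simp_rw [← Finset.mul_sum, sum_labelsProb, mul_one, sum_labelsProb]
  -- the Chernoff exponent `(ε ^ 2 / R) * s` stays in the admissible range for every `s ≤ R`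
  have hkey := sum_mul_exp_sq_le (w := w) (Y := Y) (R := R) (lam := 1e-7 * ε ^ 3 / N)
    (β := ε ^ 2 / R / 2) hsum1 hR.le
    (fun p => ⟨le_min (abs_nonneg _) hR.le, min_le_right _ _⟩) (by positivity) ?_ ?_
  · refine hkey.trans ?_
    have h2 : 2 * (1e-7 * ε ^ 3 / N) / (ε ^ 2 / R / 2 - 1e-7 * ε ^ 3 / N) = 2 / 4999 := by
      rw [hRdef]; field_simp; norm_num
    rw [h2]; norm_num
  · have : ε ^ 2 / R / 2 - 1e-7 * ε ^ 3 / N = 4.999e-4 * ε ^ 3 / N := by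
      rw [hRdef]; field_simp; norm_num
    have h3 : 0 < 4.999e-4 * ε ^ 3 / N := by positivity
    linarith
  · intro s hs
    refine le_trans (Finset.sum_le_sum fun p _ => ?_) (sum_labelsProb_tail_le (n := n) h0 h1
      (μ := ε ^ 2 / R) (s := s) (by positivity) hs.1 ?_ ?_)
    · refine mul_le_mul (hwle p) ?_ (by split_ifs <;> norm_num) (hpp p)
      split_ifs with ha hb
      · exact le_rfl
      · exact absurd (ha.trans (min_le_left _ _)) hb
      · norm_num
      · exact le_rfl
    · rw [div_mul_eq_mul_div, div_le_iff₀ hR]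
      gcongr; exact hs.2
    · have h5 : (n : ℝ) * (ε ^ 2 / R) ≤ N * (ε ^ 2 / R) := by gcongr
      refine h5.trans ?_
      have : N * (ε ^ 2 / R) = ε ^ 2 * (ε / 1000) := by rw [hRdef]; field_simp
      rw [this]
      nlinarith [sq_nonneg ε]

end

/-! ### Testing bounds from a truncated second moment -/

/-- If `D` has density `L + L'` with respect to `P`, where `L'` has small mass and `L` has second
moment close to `1`, then no bounded test distinguishes `P` from `D`. -/
theorem abs_integral_sub_integral_le {Ω : Type*} [MeasurableSpace Ω] {P D : Measure Ω}
    [IsProbabilityMeasure P] [IsProbabilityMeasure D] {L L' : Ω → ℝ≥0∞} (hL : Measurable L)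
    (hL' : Measurable L') (hD : D = P.withDensity (L + L')) {δ η : ℝ}
    (hδ : 0 ≤ δ) (h1 : ∫⁻ x, L' x ∂P ≤ ENNReal.ofReal δ) (hη : 0 ≤ η)
    (h2 : ∫⁻ x, L x ^ 2 ∂P ≤ ENNReal.ofReal (1 + η))
    {φ : Ω → ℝ} (hφ : Measurable φ) (hφ01 : ∀ x, φ x ∈ Set.Icc (0 : ℝ) 1) :
    |∫ x, φ x ∂P - ∫ x, φ x ∂D| ≤ δ + √(2 * δ + η) := by
  have htot : ∫⁻ x, L x ∂P + ∫⁻ x, L' x ∂P = 1 := by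
    rw [← lintegral_add_left hL]
    have := measure_univ (μ := D)
    rwa [hD, withDensity_apply _ MeasurableSet.univ, setLIntegral_univ] at this
  have hLt : ∫⁻ x, L x ∂P ≠ ∞ := fun h => by simp [h] at htot
  have hLt' : ∫⁻ x, L' x ∂P ≠ ∞ := fun h => by simp [h] at htot
  have hL2t : ∫⁻ x, L x ^ 2 ∂P ≠ ∞ := ne_top_of_le_ne_top ENNReal.ofReal_ne_top h2
  have hfin := ae_lt_top hL hLt
  have hfin' := ae_lt_top hL' hLt'
  set l : Ω → ℝ := fun x => (L x).toReal with hl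
  set l' : Ω → ℝ := fun x => (L' x).toReal with hl'
  have il : Integrable l P := integrable_toReal_of_lintegral_ne_top hL.aemeasurable hLt
  have il' : Integrable l' P := integrable_toReal_of_lintegral_ne_top hL'.aemeasurable hLt'
  have il2 : Integrable (fun x => l x ^ 2) P := by
    have := integrable_toReal_of_lintegral_ne_top (hL.pow_const 2).aemeasurable hL2t
    simpa only [ENNReal.toReal_pow] using this
  have el : ∫ x, l x ∂P = (∫⁻ x, L x ∂P).toReal := integral_toReal hL.aemeasurable hfin
  have el' : ∫ x, l' x ∂P = (∫⁻ x, L' x ∂P).toReal := integral_toReal hL'.aemeasurable hfin'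
  have el2 : ∫ x, l x ^ 2 ∂P ≤ 1 + η := by
    have : ∫ x, l x ^ 2 ∂P = (∫⁻ x, L x ^ 2 ∂P).toReal := by
      rw [← integral_toReal (hL.pow_const 2).aemeasurable
        (hfin.mono fun x hx => ENNReal.pow_lt_top hx)]
      simp only [ENNReal.toReal_pow, hl]
    rw [this]
    exact ENNReal.toReal_le_of_le_ofReal (by linarith) h2
  have hl'δ : ∫ x, l' x ∂P ≤ δ := by
    rw [el']; exact ENNReal.toReal_le_of_le_ofReal hδ h1
  have hll : ∫ x, l x ∂P + ∫ x, l' x ∂P = 1 := by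
    rw [el, el', ← ENNReal.toReal_add hLt hLt', htot, ENNReal.toReal_one]
  have hDint : ∫ x, φ x ∂D = ∫ x, φ x * l x ∂P + ∫ x, φ x * l' x ∂P := by
    rw [hD, integral_withDensity_eq_integral_toReal_smul (hL.add hL')
      ((hfin.and hfin').mono fun x hx => ENNReal.add_lt_top.2 hx), ← integral_add]
    · refine integral_congr_ae ((hfin.and hfin').mono fun x hx => ?_)
      simp only [Pi.add_apply, smul_eq_mul, hl, hl']
      rw [ENNReal.toReal_add hx.1.ne hx.2.ne]; ring
    · exact il.bdd_mul hφ.aestronglyMeasurable (c := 1) (Filter.Eventually.of_forall fun x => by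
        rw [Real.norm_eq_abs, abs_of_nonneg (hφ01 x).1]; exact (hφ01 x).2)
    · exact il'.bdd_mul hφ.aestronglyMeasurable (c := 1) (Filter.Eventually.of_forall fun x => by
        rw [Real.norm_eq_abs, abs_of_nonneg (hφ01 x).1]; exact (hφ01 x).2)
  have iφ : Integrable φ P := Integrable.of_bound hφ.aestronglyMeasurable 1
    (Filter.Eventually.of_forall fun x => by
        rw [Real.norm_eq_abs, abs_of_nonneg (hφ01 x).1]; exact (hφ01 x).2)
  have iφl : Integrable (fun x => φ x * l x) P :=
    il.bdd_mul hφ.aestronglyMeasurable (c := 1) (Filter.Eventually.of_forall fun x => by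
        rw [Real.norm_eq_abs, abs_of_nonneg (hφ01 x).1]; exact (hφ01 x).2)
  have i1 : Integrable (fun x => |1 - l x|) P := ((integrable_const 1).sub il).abs
  -- `∫ |1 - l| ≤ (∫ (1 - l)²)^(1/2)`, where `∫ (1 - l)² = 1 - 2 ∫ l + ∫ l²`
  have hcs : ∫ x, |1 - l x| ∂P ≤ √(2 * δ + η) := by
    set a := ∫ x, |1 - l x| ∂P
    apply Real.le_sqrt_of_sq_le
    have e1 : ∫ x, (|1 - l x| - a) ^ 2 ∂P = 1 - 2 * ∫ x, l x ∂P + ∫ x, l x ^ 2 ∂P - a ^ 2 := by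
      have : ∀ x, (|1 - l x| - a) ^ 2 =
          (1 + a ^ 2) - 2 * l x + l x ^ 2 - 2 * a * |1 - l x| := fun x => by
        rw [sub_sq, sq_abs]; ring
      simp_rw [this]
      have j1 : Integrable (fun x => (1 + a ^ 2) - 2 * l x) P :=
        (integrable_const _).sub (il.const_mul 2)
      have j2 : Integrable (fun x => (1 + a ^ 2) - 2 * l x + l x ^ 2) P := j1.add il2
      rw [integral_sub j2 (i1.const_mul _), integral_add j1 il2,
        integral_sub (integrable_const _) (il.const_mul 2), integral_const_mul,
        integral_const_mul, integral_const, probReal_univ, one_smul]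
      ring
    have e2 : 0 ≤ ∫ x, (|1 - l x| - a) ^ 2 ∂P := integral_nonneg fun x => sq_nonneg _
    linarith
  have hA : |∫ x, φ x ∂P - ∫ x, φ x * l x ∂P| ≤ √(2 * δ + η) := by
    rw [← integral_sub iφ iφl]
    refine (abs_integral_le_integral_abs).trans (le_trans ?_ hcs)
    refine integral_mono (iφ.sub iφl).abs i1 fun x => ?_
    have : φ x - φ x * l x = φ x * (1 - l x) := by ring
    simp only [this, abs_mul, abs_of_nonneg (hφ01 x).1]
    exact mul_le_of_le_one_left (abs_nonneg _) (hφ01 x).2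
  have hB : ∫ x, φ x * l' x ∂P ≤ δ := by
    refine le_trans (integral_mono_of_nonneg (Filter.Eventually.of_forall fun x =>
      mul_nonneg (hφ01 x).1 ENNReal.toReal_nonneg) il' (Filter.Eventually.of_forall fun x =>
      mul_le_of_le_one_left ENNReal.toReal_nonneg (hφ01 x).2)) hl'δ
  have hB0 : 0 ≤ ∫ x, φ x * l' x ∂P :=
    integral_nonneg fun x => mul_nonneg (hφ01 x).1 ENNReal.toReal_nonneg
  rw [hDint, abs_le]
  rw [abs_le] at hA
  constructor <;> linarith [hA.1, hA.2]

/-! ### The likelihood ratio of the alternative -/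

/-- The prior `N(0, I / d)` on the direction `v`. -/
noncomputable def prior (d : ℕ) : Measure (EuclideanSpace ℝ (Fin d)) :=
  multivariateGaussian (0 : EuclideanSpace ℝ (Fin d))
    ((1 / (d : ℝ)) • (1 : Matrix (Fin d) (Fin d) ℝ))

instance (d : ℕ) : IsProbabilityMeasure (prior d) := by
  unfold prior; infer_instance

instance (d n : ℕ) : IsProbabilityMeasure (nullLaw d n) := by
  unfold nullLaw iidLaw; infer_instance

theorem lintegral_prior {d : ℕ} {f : EuclideanSpace ℝ (Fin d) → ℝ≥0∞} (hf : Measurable f) :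
    ∫⁻ v, f v ∂(prior d) = ∫⁻ x, f ((√(d : ℝ))⁻¹ • x) ∂(gaussI 0) := by
  rw [prior, multivariateGaussian_prior_eq_map, lintegral_map hf (by fun_prop)]

theorem inv_sqrt_one_sub_le_exp {y : ℝ} (h0 : 0 ≤ y) (h : y ≤ 1 / 2) :
    (√(1 - y))⁻¹ ≤ Real.exp y := by
  have h1 : (Real.exp y)⁻¹ ≤ √(1 - y) := by
    apply Real.le_sqrt_of_sq_le
    rw [inv_pow, ← Real.exp_nat_mul, inv_le_comm₀ (Real.exp_pos _) (by linarith)]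
    refine le_trans ?_ (Real.add_one_le_exp _)
    rw [inv_le_iff_one_le_mul₀ (by linarith)]
    push_cast
    nlinarith
  exact inv_le_of_inv_le₀ (Real.exp_pos _) h1

theorem lintegral_prior_exp_inner_le {d : ℕ} (hd : 1 ≤ d) {κ : ℝ} (hκ : (κ / d) ^ 2 ≤ 1 / 2) :
    ∫⁻ v, ∫⁻ v', ENNReal.ofReal (Real.exp (κ * inner ℝ v v')) ∂(prior d) ∂(prior d) ≤
      ENNReal.ofReal (Real.exp (κ ^ 2 / d)) := by
  have hd0 : (0 : ℝ) < d := by exact_mod_cast hd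
  have hsq : √(d : ℝ) ^ 2 = d := Real.sq_sqrt hd0.le
  have h1 (v : EuclideanSpace ℝ (Fin d)) :
      ∫⁻ v', ENNReal.ofReal (Real.exp (κ * inner ℝ v v')) ∂(prior d) =
        ENNReal.ofReal (Real.exp (κ ^ 2 / (2 * d) * ‖v‖ ^ 2)) := by
    rw [lintegral_prior (by fun_prop)]
    have (x : EuclideanSpace ℝ (Fin d)) : κ * inner ℝ v ((√(d : ℝ))⁻¹ • x) =
        inner ℝ ((κ * (√(d : ℝ))⁻¹) • v) x := by
      rw [real_inner_smul_left, real_inner_smul_right]; ring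
    simp_rw [this]
    rw [lintegral_exp_inner, norm_smul, mul_pow, Real.norm_eq_abs, sq_abs, mul_pow, inv_pow, hsq]
    congr 2
    field_simp
  simp_rw [h1]
  rw [lintegral_prior (by fun_prop)]
  have h2 (x : EuclideanSpace ℝ (Fin d)) :
      κ ^ 2 / (2 * d) * ‖(√(d : ℝ))⁻¹ • x‖ ^ 2 = (κ / d) ^ 2 / 2 * ‖x‖ ^ 2 := by
    rw [norm_smul, mul_pow, Real.norm_eq_abs, sq_abs, inv_pow, hsq]
    field_simp
  simp_rw [h2]
  rw [lintegral_exp_mul_norm_sq (by linarith)]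
  apply ENNReal.ofReal_le_ofReal
  have h3 : κ ^ 2 / d = d * (κ / d) ^ 2 := by field_simp
  rw [h3, Real.exp_nat_mul]
  refine pow_le_pow_left₀ (by positivity) ?_ _
  rw [mul_div_cancel₀ _ two_ne_zero]
  exact inv_sqrt_one_sub_le_exp (sq_nonneg _) hκ

/-- The likelihood ratio, with respect to `nullLaw d n`, of independent samples with direction `v`
and labels `z`. -/
noncomputable def labelsLR {d n : ℕ} (ε α : ℝ) (z : Fin n → Bool)
    (v : EuclideanSpace ℝ (Fin d)) (x : Fin n → EuclideanSpace ℝ (Fin d)) : ℝ≥0∞ :=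
  ∏ i, gaussLR ((α * label ε (z i)) • v) (x i)

/-- The likelihood ratio, with respect to `nullLaw d n`, of samples with labels `z` and a direction
drawn from the prior. -/
noncomputable def mixLR {d n : ℕ} (ε α : ℝ) (z : Fin n → Bool)
    (x : Fin n → EuclideanSpace ℝ (Fin d)) : ℝ≥0∞ :=
  ∫⁻ v, labelsLR ε α z v x ∂(prior d)

section

variable {d n : ℕ} {ε α : ℝ}

@[fun_prop]
theorem Measurable.labelsLR {Ω : Type*} [MeasurableSpace Ω] (z : Fin n → Bool)
    {f : Ω → EuclideanSpace ℝ (Fin d)} {g : Ω → Fin n → EuclideanSpace ℝ (Fin d)}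
    (hf : Measurable f) (hg : Measurable g) :
    Measurable fun ω => labelsLR ε α z (f ω) (g ω) := by
  unfold _root_.labelsLR
  fun_prop

theorem measurable_mixLR (z : Fin n → Bool) :
    Measurable (mixLR ε α z : (Fin n → EuclideanSpace ℝ (Fin d)) → ℝ≥0∞) := by
  unfold mixLR
  exact Measurable.lintegral_prod_right'
    (f := fun p : (Fin n → EuclideanSpace ℝ (Fin d)) × EuclideanSpace ℝ (Fin d) =>
      labelsLR ε α z p.2 p.1) (by fun_prop)

theorem altSample_eq_withDensity (v : EuclideanSpace ℝ (Fin d)) :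
    altSample ε α v = (gaussI 0).withDensity fun x =>
      ∑ b, ENNReal.ofReal (labelProb ε b) * gaussLR ((α * label ε b) • v) x := by
  rw [altSample, huberMix, gaussI_eq_withDensity (α • v), gaussI_eq_withDensity (_ • v),
    ← withDensity_smul _ (by fun_prop), ← withDensity_smul _ (by fun_prop),
    ← withDensity_add_left (by fun_prop)]
  congr 1
  ext x
  simp [label, labelProb, mul_comm, add_comm]

theorem iidLaw_altSample_eq_withDensity (h0 : 0 ≤ ε) (h1 : ε ≤ 1)
    (v : EuclideanSpace ℝ (Fin d)) :
    iidLaw n (altSample ε α v) = (nullLaw d n).withDensity fun x =>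
      ∑ z : Fin n → Bool, ENNReal.ofReal (labelsProb ε z) * labelsLR ε α z v x := by
  have hp : IsProbabilityMeasure (altSample ε α v) := huberMix_isProbabilityMeasure h0 h1 _ _
  have hp' : SigmaFinite ((gaussI 0).withDensity fun x =>
      ∑ b, ENNReal.ofReal (labelProb ε b) * gaussLR ((α * label ε b) • v) x) := by
    rw [← altSample_eq_withDensity]; infer_instance
  rw [iidLaw, altSample_eq_withDensity,
    pi_withDensity (fun _ : Fin n => gaussI (0 : EuclideanSpace ℝ (Fin d)))
      (f := fun _ x => ∑ b, ENNReal.ofReal (labelProb ε b) * gaussLR ((α * label ε b) • v) x)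
      fun i => by fun_prop]
  unfold nullLaw iidLaw
  congr 1
  ext x
  rw [← sum_prod_apply fun i b =>
    ENNReal.ofReal (labelProb ε b) * gaussLR ((α * label ε b) • v) (x i)]
  refine Finset.sum_congr rfl fun z _ => ?_
  rw [Finset.prod_mul_distrib, labelsProb, labelsLR,
    ENNReal.ofReal_prod_of_nonneg fun i _ => labelProb_nonneg h0 h1 _]

theorem altLaw_eq_withDensity (h0 : 0 ≤ ε) (h1 : ε ≤ 1) :
    altLaw d n ε α = (nullLaw d n).withDensity fun x =>
      ∑ z : Fin n → Bool, ENNReal.ofReal (labelsProb ε z) * mixLR ε α z x := by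
  ext s hs
  rw [altLaw, Measure.bind_apply hs (measurable_iidLaw_altSample n α h0 h1).aemeasurable,
    withDensity_apply _ hs]
  simp_rw [iidLaw_altSample_eq_withDensity h0 h1, withDensity_apply _ hs]
  change ∫⁻ v, _ ∂(prior d) = _
  rw [lintegral_lintegral_swap (Measurable.aemeasurable (by fun_prop))]
  refine lintegral_congr fun x => ?_
  rw [lintegral_finsetSum _ fun z _ => by fun_prop]
  refine Finset.sum_congr rfl fun z _ => ?_
  rw [lintegral_const_mul _ (by fun_prop)]
  rfl

theorem lintegral_labelsLR (z : Fin n → Bool) (v : EuclideanSpace ℝ (Fin d)) :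
    ∫⁻ x, labelsLR ε α z v x ∂(nullLaw d n) = 1 := by
  simp_rw [labelsLR, nullLaw, iidLaw]
  rw [lintegral_pi_prod (fun _ : Fin n => gaussI (0 : EuclideanSpace ℝ (Fin d)))
    (f := fun i x => gaussLR ((α * label ε (z i)) • v) x) fun i => by fun_prop]
  simp [lintegral_gaussLR]

theorem lintegral_mixLR (z : Fin n → Bool) :
    ∫⁻ x : Fin n → EuclideanSpace ℝ (Fin d), mixLR ε α z x ∂(nullLaw d n) = 1 := by
  simp_rw [mixLR]
  rw [lintegral_lintegral_swap (Measurable.aemeasurable (by fun_prop))]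
  simp [lintegral_labelsLR]

theorem lintegral_labelsLR_mul (z z' : Fin n → Bool) (v v' : EuclideanSpace ℝ (Fin d)) :
    ∫⁻ x, labelsLR ε α z v x * labelsLR ε α z' v' x ∂(nullLaw d n) =
      ENNReal.ofReal (Real.exp (α ^ 2 * labelDot ε z z' * inner ℝ v v')) := by
  simp_rw [labelsLR, nullLaw, iidLaw, ← Finset.prod_mul_distrib]
  rw [lintegral_pi_prod (fun _ : Fin n => gaussI (0 : EuclideanSpace ℝ (Fin d)))
    (f := fun i x => gaussLR ((α * label ε (z i)) • v) x * gaussLR ((α * label ε (z' i)) • v') x)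
    fun i => by fun_prop]
  simp_rw [lintegral_gaussLR_mul]
  rw [← ENNReal.ofReal_prod_of_nonneg fun i _ => (Real.exp_pos _).le, ← Real.exp_sum, labelDot,
    Finset.mul_sum, Finset.sum_mul]
  congr 2
  refine Finset.sum_congr rfl fun i _ => ?_
  rw [real_inner_smul_left, real_inner_smul_right]; ring

/-- Averaging over the direction turns a pair of label vectors into a pair of rank-one spiked
Gaussians, whose chi-square inner product only depends on the inner product of the labels. -/
theorem lintegral_mixLR_mul_le (hd : 1 ≤ d) (z z' : Fin n → Bool)
    (h : (α ^ 2 * labelDot ε z z' / d) ^ 2 ≤ 1 / 2) :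
    ∫⁻ x : Fin n → EuclideanSpace ℝ (Fin d), mixLR ε α z x * mixLR ε α z' x ∂(nullLaw d n) ≤
      ENNReal.ofReal (Real.exp (α ^ 4 / d * labelDot ε z z' ^ 2)) := by
  have h1 (x : Fin n → EuclideanSpace ℝ (Fin d)) : mixLR ε α z x * mixLR ε α z' x =
      ∫⁻ v, ∫⁻ v', labelsLR ε α z v x * labelsLR ε α z' v' x ∂(prior d) ∂(prior d) := by
    simp_rw [mixLR]
    rw [← lintegral_mul_const _ (by fun_prop)]
    exact lintegral_congr fun v => (lintegral_const_mul _ (by fun_prop)).symm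
  simp_rw [h1]
  rw [lintegral_lintegral_swap]
  · have h2 (v : EuclideanSpace ℝ (Fin d)) :
        ∫⁻ x, ∫⁻ v', labelsLR ε α z v x * labelsLR ε α z' v' x ∂(prior d) ∂(nullLaw d n) =
        ∫⁻ v', ENNReal.ofReal (Real.exp (α ^ 2 * labelDot ε z z' * inner ℝ v v')) ∂(prior d) := by
      rw [lintegral_lintegral_swap (Measurable.aemeasurable (by fun_prop))]
      simp_rw [lintegral_labelsLR_mul]
    simp_rw [h2]
    refine (lintegral_prior_exp_inner_le hd h).trans (le_of_eq ?_)
    congr 2; ring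
  · exact (Measurable.lintegral_prod_right' (f := fun p : ((Fin n → EuclideanSpace ℝ (Fin d)) ×
      EuclideanSpace ℝ (Fin d)) × EuclideanSpace ℝ (Fin d) =>
      labelsLR ε α z p.1.2 p.1.1 * labelsLR ε α z' p.2 p.1.1) (by fun_prop)).aemeasurable

end

/-! ### Indistinguishability and the lower bound for testers -/

/-- No test with values in `[0, 1]` distinguishes the null from the alternative. -/
theorem abs_integral_nullLaw_sub_altLaw_le {d n : ℕ} {ε α : ℝ} (hd : 1 ≤ d) (h0 : 0 < ε)
    (h1 : ε ≤ 1) (hα : 0 < α) (hεα : ε ≤ α) (hn : (n : ℝ) ≤ 1e-7 * ((d : ℝ) * ε ^ 3 / α ^ 4))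
    {φ : (Fin n → EuclideanSpace ℝ (Fin d)) → ℝ} (hφ : Measurable φ)
    (hφ01 : ∀ x, φ x ∈ Set.Icc (0 : ℝ) 1) :
    |∫ x, φ x ∂(nullLaw d n) - ∫ x, φ x ∂(altLaw d n ε α)| ≤ 0.1 := by
  classical
  have hd0 : (0 : ℝ) < d := by exact_mod_cast hd
  set N := 1e-7 * ((d : ℝ) * ε ^ 3 / α ^ 4) with hN
  have hNpos : 0 < N := by positivity
  set R := 1000 * N / ε with hRdef
  have hR : 0 < R := by positivity
  set L : (Fin n → EuclideanSpace ℝ (Fin d)) → ℝ≥0∞ := fun x =>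
    ∑ z : Fin n → Bool with labelDot ε z z ≤ R, ENNReal.ofReal (labelsProb ε z) * mixLR ε α z x
    with hL
  set L' : (Fin n → EuclideanSpace ℝ (Fin d)) → ℝ≥0∞ := fun x =>
    ∑ z : Fin n → Bool with ¬ labelDot ε z z ≤ R,
      ENNReal.ofReal (labelsProb ε z) * mixLR ε α z x with hL'
  have hterm (z : Fin n → Bool) : Measurable fun x : Fin n → EuclideanSpace ℝ (Fin d) =>
      ENNReal.ofReal (labelsProb ε z) * mixLR ε α z x := (measurable_mixLR z).const_mul _
  have hLm : Measurable L := Finset.measurable_sum _ fun z _ => hterm z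
  have hLm' : Measurable L' := Finset.measurable_sum _ fun z _ => hterm z
  have hprob (z : Fin n → Bool) := labelsProb_nonneg (n := n) h0.le h1 z
  have hD : altLaw d n ε α = (nullLaw d n).withDensity (L + L') := by
    rw [altLaw_eq_withDensity h0.le h1]
    congr 1
    ext x
    exact (Finset.sum_filter_add_sum_filter_not _ _ _).symm
  have hbad : ∫⁻ x, L' x ∂(nullLaw d n) ≤ ENNReal.ofReal 0.001 := by
    rw [hL', lintegral_finsetSum _ fun z _ => hterm z]
    simp_rw [lintegral_const_mul _ (measurable_mixLR _), lintegral_mixLR, mul_one]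
    rw [← ENNReal.ofReal_sum_of_nonneg fun z _ => hprob z]
    refine ENNReal.ofReal_le_ofReal ((sum_labelsProb_filter_le h0 h1 hR).trans ?_)
    have h2 : N / ε / R = 0.001 := by rw [hRdef]; field_simp; norm_num
    rw [← h2]
    gcongr
  -- the truncation radius keeps the spikes of the rank-one covariances small, since `ε ≤ α`
  have hspike : α ^ 2 * R / d ≤ 1e-4 := by
    have : α ^ 2 * R / d = 1e-4 * (ε / α) ^ 2 := by
      rw [hRdef, hN]; field_simp; norm_num
    rw [this]
    have h3 : ε / α ≤ 1 := (div_le_one hα).2 hεα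
    have h4 : (ε / α) ^ 2 ≤ 1 := pow_le_one₀ (by positivity) h3
    linarith
  have hpair (z z' : Fin n → Bool) (hz : labelDot ε z z ≤ R) (hz' : labelDot ε z' z' ≤ R) :
      ∫⁻ x : Fin n → EuclideanSpace ℝ (Fin d), mixLR ε α z x * mixLR ε α z' x ∂(nullLaw d n) ≤
        ENNReal.ofReal (Real.exp (1e-7 * ε ^ 3 / N * labelDot ε z z' ^ 2)) := by
    have h5 : 1e-7 * ε ^ 3 / N = α ^ 4 / d := by rw [hN]; field_simp
    rw [h5]
    refine lintegral_mixLR_mul_le hd z z' ?_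
    have h6 : |α ^ 2 * labelDot ε z z' / d| ≤ 1e-4 := by
      rw [abs_div, abs_mul, abs_of_pos hd0, abs_of_nonneg (sq_nonneg α)]
      refine le_trans ?_ hspike
      gcongr
      exact abs_labelDot_le z z' hz hz'
    rw [← sq_abs]
    nlinarith [abs_nonneg (α ^ 2 * labelDot ε z z' / d)]
  have hgood : ∫⁻ x, L x ^ 2 ∂(nullLaw d n) ≤ ENNReal.ofReal (1 + 0.001) := by
    have h7 (x) : L x ^ 2 = ∑ z : Fin n → Bool with labelDot ε z z ≤ R,
        ∑ z' : Fin n → Bool with labelDot ε z' z' ≤ R,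
          ENNReal.ofReal (labelsProb ε z * labelsProb ε z') *
            (mixLR ε α z x * mixLR ε α z' x) := by
      rw [sq, hL, Finset.sum_mul_sum]
      refine Finset.sum_congr rfl fun z _ => Finset.sum_congr rfl fun z' _ => ?_
      rw [ENNReal.ofReal_mul (hprob z)]; ring
    have hm (z z' : Fin n → Bool) : Measurable fun x : Fin n → EuclideanSpace ℝ (Fin d) =>
        mixLR ε α z x * mixLR ε α z' x := (measurable_mixLR z).mul (measurable_mixLR z')
    simp_rw [h7]
    rw [lintegral_finsetSum _ fun z _ => Finset.measurable_sum _ fun z' _ => (hm z z').const_mul _]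
    simp_rw [lintegral_finsetSum _ fun z' _ => (hm _ z').const_mul _,
      lintegral_const_mul _ (hm _ _)]
    calc _ ≤ ∑ z : Fin n → Bool with labelDot ε z z ≤ R,
          ∑ z' : Fin n → Bool with labelDot ε z' z' ≤ R, ENNReal.ofReal (labelsProb ε z *
            labelsProb ε z' * Real.exp (1e-7 * ε ^ 3 / N * labelDot ε z z' ^ 2)) := by
          refine Finset.sum_le_sum fun z hz => Finset.sum_le_sum fun z' hz' => ?_
          rw [ENNReal.ofReal_mul (mul_nonneg (hprob z) (hprob z'))]
          gcongr
          exact hpair z z' (Finset.mem_filter.1 hz).2 (Finset.mem_filter.1 hz').2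
      _ = ENNReal.ofReal (∑ z : Fin n → Bool with labelDot ε z z ≤ R,
          ∑ z' : Fin n → Bool with labelDot ε z' z' ≤ R, labelsProb ε z *
            labelsProb ε z' * Real.exp (1e-7 * ε ^ 3 / N * labelDot ε z z' ^ 2)) := by
          have hnn (z z' : Fin n → Bool) : 0 ≤ labelsProb ε z * labelsProb ε z' *
              Real.exp (1e-7 * ε ^ 3 / N * labelDot ε z z' ^ 2) :=
            mul_nonneg (mul_nonneg (hprob z) (hprob z')) (Real.exp_pos _).le
          rw [ENNReal.ofReal_sum_of_nonneg fun z _ => Finset.sum_nonneg fun z' _ => hnn z z']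
          exact Finset.sum_congr rfl fun z _ =>
            (ENNReal.ofReal_sum_of_nonneg fun z' _ => hnn z z').symm
      _ ≤ ENNReal.ofReal (1 + 0.001) := by
          refine ENNReal.ofReal_le_ofReal
            ((sum_filter_exp_labelDot_sq_le h0 h1 hNpos hn).trans ?_)
          norm_num
  have := altLaw_isProbabilityMeasure d n (ε := ε) α h0.le h1
  refine (abs_integral_sub_integral_le hLm hLm' hD (by norm_num) hbad (by norm_num) hgood hφ
    hφ01).trans ?_
  have h8 : √(2 * 0.001 + 0.001 : ℝ) ≤ 0.09 := by
    rw [Real.sqrt_le_left (by norm_num)]; norm_num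
  linarith

/-- A direction drawn from the prior has norm at least `1 / 2`, except with probability
exponentially small in `d`, here bounded by `4 / d`. -/
theorem prior_norm_lt_le {d : ℕ} (hd : 1 ≤ d) :
    prior d {v | ‖v‖ < 1 / 2} ≤ ENNReal.ofReal (4 / d) := by
  have hd0 : (0 : ℝ) < d := by exact_mod_cast hd
  have hms : MeasurableSet {v : EuclideanSpace ℝ (Fin d) | ‖v‖ < 1 / 2} :=
    measurableSet_lt measurable_norm measurable_const
  rw [← lintegral_indicator_one hms]
  calc ∫⁻ v, {v : EuclideanSpace ℝ (Fin d) | ‖v‖ < 1 / 2}.indicator 1 v ∂(prior d)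
      ≤ ∫⁻ v, ENNReal.ofReal (Real.exp (d / 4)) * ENNReal.ofReal (Real.exp (-d * ‖v‖ ^ 2))
          ∂(prior d) := by
        refine lintegral_mono fun v => ?_
        by_cases hv : ‖v‖ < 1 / 2
        · rw [Set.indicator_of_mem (by exact hv), ← ENNReal.ofReal_mul (Real.exp_pos _).le,
            ← Real.exp_add, Pi.one_apply, ENNReal.one_le_ofReal]
          apply Real.one_le_exp
          have : ‖v‖ ^ 2 ≤ 1 / 4 := by nlinarith [norm_nonneg v]
          nlinarith
        · rw [Set.indicator_of_notMem (by exact hv)]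
          exact zero_le
    _ = ENNReal.ofReal (Real.exp (d / 4) * (√3)⁻¹ ^ d) := by
        rw [lintegral_const_mul _ (by fun_prop), lintegral_prior (by fun_prop)]
        have h (x : EuclideanSpace ℝ (Fin d)) :
            -(d : ℝ) * ‖(√(d : ℝ))⁻¹ • x‖ ^ 2 = -1 * ‖x‖ ^ 2 := by
          rw [norm_smul, mul_pow, Real.norm_eq_abs, sq_abs, inv_pow, Real.sq_sqrt hd0.le]
          field_simp
        simp_rw [h]
        rw [lintegral_exp_mul_norm_sq (by norm_num), ENNReal.ofReal_mul (Real.exp_pos _).le]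
        norm_num
    _ ≤ ENNReal.ofReal (4 / d) := by
        apply ENNReal.ofReal_le_ofReal
        have h3 : (√3)⁻¹ ≤ Real.exp (-(1 / 2)) := by
          rw [Real.exp_neg]
          refine inv_anti₀ (Real.exp_pos _) (Real.le_sqrt_of_sq_le ?_)
          rw [← Real.exp_nat_mul]
          norm_num
          linarith [Real.exp_one_lt_d9]
        calc Real.exp (d / 4) * (√3)⁻¹ ^ d
            ≤ Real.exp (d / 4) * Real.exp (-(1 / 2)) ^ d := by gcongr
          _ = (Real.exp (d / 4))⁻¹ := by
              rw [← Real.exp_nat_mul, ← Real.exp_add, ← Real.exp_neg]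
              congr 1; ring
          _ ≤ (d / 4 : ℝ)⁻¹ := by
              refine inv_anti₀ (by positivity) ?_
              linarith [Real.add_one_le_exp (d / 4 : ℝ)]
          _ = 4 / d := inv_div _ _

/-- A tester with separation `α` rejects the alternative with parameter `2 * α` with probability
about `2 / 3`, because the mean `2 * α • v` of the inliers has norm at least `α` unless
`‖v‖ < 1 / 2`. -/
theorem IsHuberMeanTester.le_integral_altLaw {d n : ℕ} {ε α : ℝ}
    {φ : (Fin n → EuclideanSpace ℝ (Fin d)) → ℝ} (hφ : IsHuberMeanTester d n ε α φ)
    (hd : 1 ≤ d) (h0 : 0 ≤ ε) (h1 : ε ≤ 1) (hα : 0 < α) :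
    2 / 3 * (1 - 4 / d) ≤ ∫ x, φ x ∂(altLaw d n ε (2 * α)) := by
  have hprob := altLaw_isProbabilityMeasure d n (ε := ε) (2 * α) h0 h1
  have hofReal {μ : Measure (Fin n → EuclideanSpace ℝ (Fin d))} [IsProbabilityMeasure μ] :
      ENNReal.ofReal (∫ x, φ x ∂μ) = ∫⁻ x, ENNReal.ofReal (φ x) ∂μ :=
    ofReal_integral_eq_lintegral_ofReal
      (Integrable.of_bound hφ.measurable.aestronglyMeasurable 1
        (Filter.Eventually.of_forall fun x => by
          rw [Real.norm_eq_abs, abs_of_nonneg (hφ.mem_Icc x).1]; exact (hφ.mem_Icc x).2))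
      (Filter.Eventually.of_forall fun x => (hφ.mem_Icc x).1)
  have hnn : 0 ≤ ∫ x, φ x ∂(altLaw d n ε (2 * α)) := integral_nonneg fun x => (hφ.mem_Icc x).1
  set S : Set (EuclideanSpace ℝ (Fin d)) := {v | ‖v‖ < 1 / 2} with hS
  have hms : MeasurableSet S := measurableSet_lt measurable_norm measurable_const
  have hSc : 1 - 4 / (d : ℝ) ≤ (prior d).real Sᶜ := by
    rw [probReal_compl_eq_one_sub hms]
    have : (prior d).real S ≤ 4 / d :=
      ENNReal.toReal_le_of_le_ofReal (by positivity) (prior_norm_lt_le hd)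
    linarith
  have hv (v : EuclideanSpace ℝ (Fin d)) (hvS : v ∈ Sᶜ) : ENNReal.ofReal (2 / 3) ≤
      ∫⁻ x, ENNReal.ofReal (φ x) ∂(iidLaw n (altSample ε (2 * α) v)) := by
    have hp : IsProbabilityMeasure (altSample ε (2 * α) v) :=
      huberMix_isProbabilityMeasure h0 h1 _ _
    have hq : IsProbabilityMeasure (iidLaw n (altSample ε (2 * α) v)) := by
      unfold iidLaw; infer_instance
    rw [← hofReal]
    apply ENNReal.ofReal_le_ofReal
    refine hφ.alt _ _ ?_
    rw [hS, Set.mem_compl_iff, Set.mem_ofPred_eq, not_lt] at hvS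
    rw [norm_smul, Real.norm_eq_abs, abs_of_pos (by linarith)]
    nlinarith
  have hmain : ENNReal.ofReal (2 / 3) * prior d Sᶜ ≤
      ENNReal.ofReal (∫ x, φ x ∂(altLaw d n ε (2 * α))) := by
    rw [hofReal, altLaw, Measure.lintegral_bind
      (measurable_iidLaw_altSample n (2 * α) h0 h1).aemeasurable
      hφ.measurable.ennreal_ofReal.aemeasurable, ← setLIntegral_const]
    change _ ≤ ∫⁻ v, _ ∂(prior d)
    exact (setLIntegral_mono' hms.compl hv).trans (setLIntegral_le_lintegral _ _)
  have := ENNReal.toReal_le_of_le_ofReal hnn hmain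
  rw [ENNReal.toReal_mul, ENNReal.toReal_ofReal (by norm_num)] at this
  refine le_trans ?_ this
  gcongr
  exact hSc

theorem mainTheorem3 :
    ∃ c : ℝ, 0 < c ∧
      ∀ (d n : ℕ) (ε α : ℝ), 1 ≤ d → 0 ≤ ε → ε ≤ 1 → 0 < α → ε ≤ α →
        (n : ℝ) ≤ c * ((d : ℝ) * ε ^ 3 / α ^ 4) →
        Real.sqrt (d : ℝ) / α ^ 2 ≤ c * ((d : ℝ) * ε ^ 3 / α ^ 4) →
          tvDist (nullLaw d n) (altLaw d n ε α) ≤ 0.1 ∧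
          ¬ ∃ φ : (Fin n → EuclideanSpace ℝ (Fin d)) → ℝ, IsHuberMeanTester d n ε α φ := by
  -- the factor `16 = 2 ^ 4` allows the replacement of `α` by `2 * α`
  refine ⟨1e-7 / 16, by norm_num, fun d n ε α hd h0 h1 hα hεα hn hN => ?_⟩
  have hd0 : (0 : ℝ) < d := by exact_mod_cast hd
  have hsq : 0 < √(d : ℝ) := Real.sqrt_pos.2 hd0
  have hε : 0 < ε := by
    rcases h0.lt_or_eq with h | h
    · exact h
    · rw [← h] at hN
      norm_num at hN
      have : 0 < √(d : ℝ) / α ^ 2 := by positivity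
      linarith
  constructor
  · have : Nonempty {A : Set (Fin n → EuclideanSpace ℝ (Fin d)) // MeasurableSet A} :=
      ⟨⟨∅, MeasurableSet.empty⟩⟩
    refine ciSup_le fun A => ?_
    have := abs_integral_nullLaw_sub_altLaw_le hd hε h1 hα hεα
      (hn.trans (by gcongr; norm_num)) (φ := A.1.indicator 1)
      (measurable_one.indicator A.2) fun x => by
        by_cases hx : x ∈ A.1 <;> simp [hx]
    rwa [integral_indicator_one A.2, integral_indicator_one A.2] at this
  · rintro ⟨φ, hφ⟩
    have h2 := abs_integral_nullLaw_sub_altLaw_le hd hε h1 (α := 2 * α) (by linarith)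
      (by linarith) (hn.trans (le_of_eq (by field_simp; norm_num))) hφ.measurable hφ.mem_Icc
    have h3 := hφ.le_integral_altLaw hd h0 h1 hα
    have h4 := hφ.null
    -- the lower bound on `d * ε ^ 3 / α ^ 4` forces `d` to be large, so the prior concentrates
    have hlarge : 1000 ≤ (d : ℝ) := by
      rw [div_le_iff₀ (by positivity)] at hN
      have e1 : 1e-7 / 16 * ((d : ℝ) * ε ^ 3 / α ^ 4) * α ^ 2 =
          1e-7 / 16 * d * ε * (ε / α) ^ 2 := by field_simp
      rw [e1] at hN
      have e2 : (ε / α) ^ 2 ≤ 1 := pow_le_one₀ (by positivity) ((div_le_one hα).2 hεα)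
      have e3 : 1e-7 / 16 * d * ε * (ε / α) ^ 2 ≤ 1e-7 / 16 * d * 1 * 1 := by gcongr
      have e4 : 1 ≤ √(d : ℝ) := Real.one_le_sqrt.2 (by exact_mod_cast hd)
      linarith
    have h5 : 4 / (d : ℝ) ≤ 0.004 := by
      rw [div_le_iff₀ hd0]; linarith
    rw [abs_le] at h2
    linarith [h2.1]
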